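/- Let $A$ and $B$ be (not necessarily unital) complex $C^*$-algebras, and let $\varphi\colon A\to B$ be a bounded, linear map. Say that a map $f\colon C\to D$ between $C^*$-algebras preserves - *zero-products* if $ab=0$ implies $f(a)f(b)=0$, for all $a,b\in C$; - *range-orthogonality* if $a^*b=0$ implies $f(a)^*f(b)=0$, for all $a,b\in C$; - *domain-orthogonality* if $ab^*=0$ implies $f(a)f(b)^*=0$, for all $a,b\in C$; - *zero-TRO-products* if $ab^*c=0$ implies $f(a)f(b)^*f(c)=0$, for all $a,b,c\in C$. For $n\geq 1$, let $\varphi^{(n)}\colon M_n(A)\to M_n(B)$, $\varphi^{(n)}\big((a_{ij})_{i,j}\big)=(\varphi(a_{ij}))_{i,j}$, be the amplification of $\varphi$ to the $C^*$-algebras of $n\times n$ matrices. If $\varphi$ preserves zero-products (respectively, range-orthogonality, domain-orthogonality, zero-TRO-products), then $\varphi^{(n)}$ preserves zero-products (respectively, range-orthogonality, domain-orthogonality, zero-TRO-products) for every $n\geq 1$. -/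

import Mathlib

/-- `f` preserves zero-products: `a b = 0` implies `f(a) f(b) = 0`. -/
def PreservesZeroProducts {A B : Type*} [NonUnitalSemiring A] [NonUnitalSemiring B]
    (f : A → B) : Prop :=
  ∀ a b : A, a * b = 0 → f a * f b = 0

/-- `f` preserves range-orthogonality: `a* b = 0` implies `f(a)* f(b) = 0`. -/
def PreservesRangeOrthogonality {A B : Type*} [NonUnitalSemiring A] [StarRing A]
    [NonUnitalSemiring B] [StarRing B] (f : A → B) : Prop :=
  ∀ a b : A, star a * b = 0 → star (f a) * f b = 0

/-- `f` preserves domain-orthogonality: `a b* = 0` implies `f(a) f(b)* = 0`. -/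
def PreservesDomainOrthogonality {A B : Type*} [NonUnitalSemiring A] [StarRing A]
    [NonUnitalSemiring B] [StarRing B] (f : A → B) : Prop :=
  ∀ a b : A, a * star b = 0 → f a * star (f b) = 0

/-- `f` preserves zero-TRO-products: `a b* c = 0` implies `f(a) f(b)* f(c) = 0`. -/
def PreservesZeroTROProducts {A B : Type*} [NonUnitalSemiring A] [StarRing A]
    [NonUnitalSemiring B] [StarRing B] (f : A → B) : Prop :=
  ∀ a b c : A, a * star b * c = 0 → f a * star (f b) * f c = 0

/-- The amplification `φ⁽ⁿ⁾ : Mₙ(A) → Mₙ(B)`, which applies `φ` to every matrix entry.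
`CStarMatrix (Fin n) (Fin n) A` is the C⋆-algebra `Mₙ(A)`: its product is matrix multiplication
and its involution is the conjugate transpose. -/
def amplification {A B : Type*} [NonUnitalCStarAlgebra A] [NonUnitalCStarAlgebra B]
    (φ : A →L[ℂ] B) (n : ℕ) :
    CStarMatrix (Fin n) (Fin n) A →ₗ[ℂ] CStarMatrix (Fin n) (Fin n) B :=
  CStarMatrix.mapₗ (φ : A →ₗ[ℂ] B)

/-! An entry of a matrix product is a sum `∑ x k * y k`, so it suffices that a bounded bilinear `V`
killing pairs with `a * b = 0` also kills families with vanishing sum of products. This follows from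
the balance law `V (a * b) c = V a (b * c)` (`map_mul_of_zero_product`) and an approximate unit. For
self-adjoint `b`, functional calculus reduces the law to `W f 1 = W 1 f` on continuous functions
(`bilin_one_comm`): `N` times the defect stays bounded as `N` grows. The starred versions replace
`φ` by `a ↦ φ(a*)*` in the starred slot; triple products apply the law twice. -/

open Finset in
/-- The staircase of truncations of `t` at consecutive integers sums up to `min n t`. -/
theorem sum_range_clamp_sub (t : ℝ) (ht : 0 ≤ t) (n : ℕ) :
    ∑ k ∈ range n, max 0 (min 1 (t - k)) = min (n : ℝ) t := by
  induction n with
  | zero => simp [ht]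
  | succ n ih =>
    rw [sum_range_succ, ih]
    push_cast
    rcases le_total t n with h | h
    · rw [min_eq_right h, min_eq_right (by linarith), min_eq_right (by linarith),
        max_eq_left (by linarith)]
      ring
    · rw [min_eq_left h]
      rcases le_total t (n + 1) with h' | h'
      · rw [min_eq_right h', min_eq_right (by linarith), max_eq_right (by linarith)]
        ring
      · rw [min_eq_left h', min_eq_left (by linarith), max_eq_right (by linarith)]

/-! ### Bilinear maps on continuous functions that vanish on orthogonal pairs. -/

section Disjointness

variable {X E : Type*} [TopologicalSpace X] [NormedAddCommGroup E] [NormedSpace ℝ E]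

open Finset

/-- The ramp function `min 1 (N f + 1 - k)`, truncated below at `0`. -/
def ContinuousMap.ramp (f : C(X, ℝ)) (N k : ℕ) : C(X, ℝ) where
  toFun x := max 0 (min 1 (N * f x + 1 - k))

/-- The hat function cut out by two consecutive ramps. -/
def ContinuousMap.hat (f : C(X, ℝ)) (N k : ℕ) : C(X, ℝ) :=
  f.ramp N k - f.ramp N (k + 1)

namespace ContinuousMap

theorem ramp_apply (f : C(X, ℝ)) (N k : ℕ) (x : X) :
    f.ramp N k x = max 0 (min 1 (N * f x + 1 - k)) := rfl

theorem hat_apply (f : C(X, ℝ)) (N k : ℕ) (x : X) :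
    f.hat N k x = f.ramp N k x - f.ramp N (k + 1) x := rfl

theorem ramp_nonneg (f : C(X, ℝ)) (N k : ℕ) (x : X) : 0 ≤ f.ramp N k x := le_max_left _ _

theorem ramp_le_one (f : C(X, ℝ)) (N k : ℕ) (x : X) : f.ramp N k x ≤ 1 :=
  max_le zero_le_one (min_le_left _ _)

theorem ramp_eq_zero {f : C(X, ℝ)} {N k : ℕ} {x : X} (h : N * f x + 1 ≤ k) :
    f.ramp N k x = 0 := by
  rw [ramp_apply, max_eq_left]
  exact (min_le_right _ _).trans (by linarith)

theorem ramp_eq_one {f : C(X, ℝ)} {N k : ℕ} {x : X} (h : k ≤ N * f x) :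
    f.ramp N k x = 1 := by
  rw [ramp_apply, min_eq_left (by linarith), max_eq_right zero_le_one]

theorem hat_nonneg (f : C(X, ℝ)) (N k : ℕ) (x : X) : 0 ≤ f.hat N k x := by
  rw [hat_apply, sub_nonneg, ramp_apply, ramp_apply]
  push_cast
  gcongr
  linarith

theorem hat_eq_zero_of_le {f : C(X, ℝ)} {N k : ℕ} {x : X} (h : N * f x + 1 ≤ k) :
    f.hat N k x = 0 := by
  rw [hat_apply, ramp_eq_zero h, ramp_eq_zero (by push_cast; linarith), sub_zero]

theorem hat_eq_zero_of_ge {f : C(X, ℝ)} {N k : ℕ} {x : X} (h : (k : ℝ) + 1 ≤ N * f x) :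
    f.hat N k x = 0 := by
  rw [hat_apply, ramp_eq_one (by linarith), ramp_eq_one (by push_cast; linarith), sub_self]

theorem hat_mul_hat (f : C(X, ℝ)) (N : ℕ) {j k : ℕ} (h : j + 2 ≤ k) :
    f.hat N j * f.hat N k = 0 := by
  ext x
  have h' : (j : ℝ) + 2 ≤ k := by exact_mod_cast h
  rcases le_total ((j : ℝ) + 1) (N * f x) with hx | hx
  · simp [hat_eq_zero_of_ge hx]
  · simp [hat_eq_zero_of_le (show (N : ℝ) * f x + 1 ≤ k by linarith)]

theorem ramp_succ_mul_one_sub_ramp (f : C(X, ℝ)) (N k : ℕ) :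
    f.ramp N (k + 1) * (1 - f.ramp N k) = 0 := by
  ext x
  rcases le_total (k : ℝ) (N * f x) with hx | hx
  · simp [ramp_eq_one hx]
  · simp [ramp_eq_zero (show (N : ℝ) * f x + 1 ≤ (k + 1 : ℕ) by push_cast; linarith)]

theorem norm_sum_hat_le [CompactSpace X] (f : C(X, ℝ)) (N : ℕ) {n : ℕ} {S : Finset ℕ} (hS : S ⊆ range n) :
    ‖∑ k ∈ S, f.hat N k‖ ≤ 1 := by
  refine (norm_le _ zero_le_one).2 fun x => ?_
  rw [sum_apply, Real.norm_of_nonneg (sum_nonneg fun k _ => hat_nonneg f N k x)]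
  calc ∑ k ∈ S, f.hat N k x ≤ ∑ k ∈ range n, f.hat N k x :=
        sum_le_sum_of_subset_of_nonneg hS fun k _ _ => hat_nonneg f N k x
    _ = f.ramp N 0 x - f.ramp N n x := sum_range_sub' (fun k => f.ramp N k x) n
    _ ≤ 1 := by linarith [ramp_nonneg f N n x, ramp_le_one f N 0 x]

/-- By the shift in `ramp`, `ramp N (k + 1)` is the slice of `N f` between heights `k` and `k + 1`.
-/
theorem sum_ramp_succ {f : C(X, ℝ)} (hf0 : ∀ x, 0 ≤ f x) (hf1 : ∀ x, f x ≤ 1) (N : ℕ) :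
    ∑ k ∈ range N, f.ramp N (k + 1) = (N : ℝ) • f := by
  ext x
  have hN : (0 : ℝ) ≤ N := N.cast_nonneg
  rw [sum_apply, smul_apply, smul_eq_mul,
    ← min_eq_right (mul_le_of_le_one_right hN (hf1 x)),
    ← sum_range_clamp_sub _ (mul_nonneg hN (hf0 x)) N]
  refine sum_congr rfl fun k _ => ?_
  rw [ramp_apply]
  push_cast
  congr 2
  ring

end ContinuousMap

variable {W : C(X, ℝ) →ₗ[ℝ] C(X, ℝ) →ₗ[ℝ] E}

/-- A ramp equals `1` wherever a later one is nonzero, so beside the later ramp `W` may replace it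
by `1`. Expanding the hats, all else cancels. -/
theorem bilin_hat_succ_hat (hW : ∀ f g : C(X, ℝ), f * g = 0 → W f g = 0) (f : C(X, ℝ))
    (N k : ℕ) :
    W (f.ramp N (k + 1)) 1 - W 1 (f.ramp N (k + 1)) =
      W (f.hat N (k + 1)) (f.hat N k) - W (f.hat N k) (f.hat N (k + 1)) := by
  have e1 := f.ramp_succ_mul_one_sub_ramp N (k + 1)
  have e2 := f.ramp_succ_mul_one_sub_ramp N k
  have e3 : f.ramp N (k + 1 + 1) * (1 - f.ramp N k) = 0 := by
    linear_combination (1 - f.ramp N k) * e1 + f.ramp N (k + 1 + 1) * e2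
  have h1 := hW _ _ e1
  have h2 := hW _ _ e2
  have h3 := hW _ _ e3
  have h1' := hW _ _ ((mul_comm _ _).trans e1)
  have h2' := hW _ _ ((mul_comm _ _).trans e2)
  have h3' := hW _ _ ((mul_comm _ _).trans e3)
  simp only [ContinuousMap.hat, map_sub, LinearMap.sub_apply] at *
  rw [sub_eq_zero] at h1 h2 h3 h1' h2' h3'
  rw [h2, h2', ← h3, ← h3', h1, h1']
  abel

/-- A sum over pairwise orthogonal pairs is the value at the pair of sums. -/
theorem bilin_sum_sum_of_mul_eq_zero (hW : ∀ f g : C(X, ℝ), f * g = 0 → W f g = 0)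
    {ι : Type*} (S : Finset ι) (u v : ι → C(X, ℝ))
    (huv : ∀ i ∈ S, ∀ j ∈ S, i ≠ j → u i * v j = 0) :
    W (∑ i ∈ S, u i) (∑ i ∈ S, v i) = ∑ i ∈ S, W (u i) (v i) := by
  rw [map_sum W, LinearMap.sum_apply]
  refine sum_congr rfl fun i hi => ?_
  rw [map_sum]
  exact sum_eq_single i (fun j hj hji => hW _ _ (huv i hi j hj hji.symm)) (fun h => (h hi).elim)

/-- The bound does not depend on `N`. Indices congruent mod 3 differ by at least 3, so even after
the shift by one the hats are two apart, hence orthogonal. Each class then collapses to two values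
of `W` at functions of norm at most 1: three classes, two values, constant 6. -/
theorem norm_bilin_ramp_sum_le [CompactSpace X] {C : ℝ} (hC0 : 0 ≤ C)
    (hC : ∀ f g, ‖W f g‖ ≤ C * ‖f‖ * ‖g‖)
    (hW : ∀ f g : C(X, ℝ), f * g = 0 → W f g = 0) (f : C(X, ℝ)) (N : ℕ) :
    ‖∑ k ∈ range N, (W (f.ramp N (k + 1)) 1 - W 1 (f.ramp N (k + 1)))‖ ≤ 6 * C := by
  have orth : ∀ r : ℕ, ∀ i ∈ (range N).filter (· % 3 = r), ∀ j ∈ (range N).filter (· % 3 = r),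
      i ≠ j → f.hat N (i + 1) * f.hat N j = 0 := by
    intro r i hi j hj hij
    simp only [mem_filter, mem_range] at hi hj
    rcases lt_or_gt_of_ne hij with h | h
    · exact f.hat_mul_hat N (by omega)
    · rw [mul_comm]
      exact f.hat_mul_hat N (by omega)
  have small : ∀ u v : C(X, ℝ), ‖u‖ ≤ 1 → ‖v‖ ≤ 1 → ‖W u v‖ ≤ C := fun u v hu hv =>
    (hC u v).trans (by
      rw [mul_assoc]
      exact mul_le_of_le_one_right hC0 (mul_le_one₀ hu (norm_nonneg v) hv))
  have hat_sum : ∀ r : ℕ, ‖∑ k ∈ (range N).filter (· % 3 = r), f.hat N k‖ ≤ 1 := fun r =>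
    f.norm_sum_hat_le N (filter_subset _ _)
  have hat_succ_sum : ∀ r : ℕ, ‖∑ k ∈ (range N).filter (· % 3 = r), f.hat N (k + 1)‖ ≤ 1 := by
    intro r
    have := f.norm_sum_hat_le N (n := N + 1)
      (S := ((range N).filter (· % 3 = r)).map (addRightEmbedding 1)) (by
        intro k hk
        simp only [mem_map, mem_filter, mem_range, addRightEmbedding_apply] at hk ⊢
        omega)
    simpa using this
  rw [← sum_fiberwise_of_maps_to (t := range 3) (g := (· % 3))
    (fun k _ => mem_range.2 (Nat.mod_lt _ (by norm_num)))]
  refine (norm_sum_le_of_le (range 3) (f := fun r => ∑ k ∈ range N with k % 3 = r, _)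
    (n := fun _ => 2 * C) fun r _ => ?_).trans (by simp; linarith)
  rw [sum_congr rfl fun k _ => bilin_hat_succ_hat hW f N k, sum_sub_distrib,
    ← bilin_sum_sum_of_mul_eq_zero hW _ _ _ (orth r),
    ← bilin_sum_sum_of_mul_eq_zero hW _ (fun k => f.hat N k) (fun k => f.hat N (k + 1))
      (fun i hi j hj hij => (mul_comm _ _).trans (orth r j hj i hi hij.symm))]
  refine (norm_sub_le _ _).trans ?_
  linarith [small _ _ (hat_succ_sum r) (hat_sum r), small _ _ (hat_sum r) (hat_succ_sum r)]

/-- A bounded bilinear map on continuous functions that vanishes on orthogonal pairs satisfies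
`W f 1 = W 1 f`. -/
theorem bilin_one_comm [CompactSpace X] {C : ℝ} (hC0 : 0 ≤ C)
    (hC : ∀ f g, ‖W f g‖ ≤ C * ‖f‖ * ‖g‖)
    (hW : ∀ f g : C(X, ℝ), f * g = 0 → W f g = 0) (f : C(X, ℝ)) : W f 1 = W 1 f := by
  have unit : ∀ g : C(X, ℝ), (∀ x, 0 ≤ g x) → (∀ x, g x ≤ 1) → W g 1 = W 1 g := by
    intro g h0 h1
    by_contra hne
    have hpos : 0 < ‖W g 1 - W 1 g‖ := norm_pos_iff.2 (sub_ne_zero.2 hne)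
    obtain ⟨N, hN⟩ := exists_nat_gt (6 * C / ‖W g 1 - W 1 g‖)
    rw [div_lt_iff₀ hpos] at hN
    have := norm_bilin_ramp_sum_le hC0 hC hW g N
    rw [sum_sub_distrib, ← LinearMap.sum_apply, ← map_sum, ← map_sum,
      ContinuousMap.sum_ramp_succ h0 h1, map_smul, map_smul, LinearMap.smul_apply, ← smul_sub,
      norm_smul, Real.norm_natCast] at this
    linarith
  -- An affine change moves `f` into `[0, 1]`; the added constant contributes `W 1 1` to both sides.
  -- The `+ 1` keeps the scale nonzero when `f = 0`.
  have hc : 0 < ‖f‖ + 1 := by positivity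
  have key := unit ((2 * (‖f‖ + 1))⁻¹ • (f + (‖f‖ + 1) • 1))
    (fun x => by
      have := (abs_le.1 (f.norm_coe_le_norm x)).1
      simp only [ContinuousMap.smul_apply, ContinuousMap.add_apply, ContinuousMap.one_apply,
        smul_eq_mul]
      exact mul_nonneg (by positivity) (by linarith))
    (fun x => by
      have := (abs_le.1 (f.norm_coe_le_norm x)).2
      simp only [ContinuousMap.smul_apply, ContinuousMap.add_apply, ContinuousMap.one_apply,
        smul_eq_mul]
      rw [inv_mul_le_iff₀ (by positivity)]
      linarith)
  rw [map_smul, map_smul, LinearMap.smul_apply] at key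
  have := smul_right_injective E (inv_ne_zero (mul_pos two_pos hc).ne') key
  simpa using this

end Disjointness

/-! ### Bilinear maps on a C⋆-algebra that vanish on zero-products. -/

section ZeroProducts

variable {A E : Type*} [NonUnitalCStarAlgebra A] [NormedAddCommGroup E] [NormedSpace ℂ E]

open Unitization

/-- `A` is a left ideal of its unitization. -/
theorem Unitization.inr_snd_mul_inr (u : Unitization ℂ A) (b : A) :
    ((u * (b : Unitization ℂ A)).snd : Unitization ℂ A) = u * b := by
  ext <;> simp

/-- `A` is a right ideal of its unitization. -/
theorem Unitization.inr_snd_inr_mul (a : A) (u : Unitization ℂ A) :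
    (((a : Unitization ℂ A) * u).snd : Unitization ℂ A) = a * u := by
  ext <;> simp

theorem Unitization.norm_snd_mul_inr_le (u : Unitization ℂ A) (b : A) :
    ‖(u * (b : Unitization ℂ A)).snd‖ ≤ ‖u‖ * ‖b‖ := by
  rw [← norm_inr (𝕜 := ℂ), inr_snd_mul_inr, ← norm_inr (𝕜 := ℂ) b]
  exact norm_mul_le _ _

theorem Unitization.norm_snd_inr_mul_le (a : A) (u : Unitization ℂ A) :
    ‖((a : Unitization ℂ A) * u).snd‖ ≤ ‖a‖ * ‖u‖ := by
  rw [← norm_inr (𝕜 := ℂ), inr_snd_inr_mul, ← norm_inr (𝕜 := ℂ) a]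
  exact norm_mul_le _ _

/-- The constant function `1` forces the calculus into the unitization; multiplying by `a` and `b`
returns to the ideal `A`, and `snd` reads off the element. -/
theorem map_mul_selfAdjoint_of_zero_product (V : A →L[ℂ] A →L[ℂ] E)
    (hV : ∀ a b, a * b = 0 → V a b = 0) (a b : A) {h : A} (hh : IsSelfAdjoint h) :
    V (a * h) b = V a (h * b) := by
  have hh' : IsSelfAdjoint (h : Unitization ℂ A) := hh.inr ℂ
  let Φ : C(spectrum ℝ (h : Unitization ℂ A), ℝ) →⋆ₐ[ℝ] Unitization ℂ A := cfcHom hh'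
  let W : C(spectrum ℝ (h : Unitization ℂ A), ℝ) →ₗ[ℝ]
      C(spectrum ℝ (h : Unitization ℂ A), ℝ) →ₗ[ℝ] E :=
    LinearMap.mk₂ ℝ
      (fun f g => V ((a : Unitization ℂ A) * Φ f).snd (Φ g * (b : Unitization ℂ A)).snd)
      (by intros; simp only [map_add, mul_add, snd_add, _root_.add_apply])
      (by
        intro c f g
        rw [map_smul, mul_smul_comm, snd_smul, ← Complex.coe_smul, map_smul]
        simp)
      (by intros; simp only [map_add, add_mul, snd_add])
      (by
        intro c f g
        rw [map_smul, smul_mul_assoc, snd_smul, ← Complex.coe_smul, map_smul]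
        simp)
  have hWd : ∀ f g, W f g =
      V ((a : Unitization ℂ A) * Φ f).snd (Φ g * (b : Unitization ℂ A)).snd := fun _ _ => rfl
  have hΦ : ∀ f, ‖Φ f‖ = ‖f‖ := fun f => norm_cfcHom (h : Unitization ℂ A) f hh'
  have key := bilin_one_comm (W := W) (C := ‖V‖ * ‖a‖ * ‖b‖) (by positivity)
    (fun f g => by
      rw [hWd]
      refine (V.le_opNorm₂ _ _).trans ?_
      have h1 := norm_snd_inr_mul_le a (Φ f)
      have h2 := norm_snd_mul_inr_le (Φ g) b
      rw [hΦ] at h1 h2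
      calc _ ≤ ‖V‖ * (‖a‖ * ‖f‖) * (‖g‖ * ‖b‖) := by gcongr
        _ = _ := by ring)
    (fun f g hfg => by
      rw [hWd]
      refine hV _ _ (inr_injective (R := ℂ) ?_)
      rw [inr_mul, inr_snd_inr_mul, inr_snd_mul_inr, mul_assoc, ← mul_assoc (Φ f), ← map_mul,
        hfg, map_zero, zero_mul, mul_zero, inr_zero])
    ((ContinuousMap.id ℝ).restrict _)
  rw [hWd, hWd, map_one, mul_one, one_mul] at key
  simpa [Φ, cfcHom_id hh', ← inr_mul] using key

/-- A bounded bilinear map on a C⋆-algebra that vanishes on zero-products is balanced. -/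
theorem map_mul_of_zero_product (V : A →L[ℂ] A →L[ℂ] E)
    (hV : ∀ a b, a * b = 0 → V a b = 0) (a b c : A) :
    V (a * b) c = V a (b * c) := by
  rw [← realPart_add_I_smul_imaginaryPart b, mul_add, add_mul, map_add, map_add,
    _root_.add_apply, mul_smul_comm, smul_mul_assoc, map_smul, map_smul,
    _root_.smul_apply,
    map_mul_selfAdjoint_of_zero_product V hV a c (realPart b).2,
    map_mul_selfAdjoint_of_zero_product V hV a c (imaginaryPart b).2]

theorem exists_approximateUnit (A : Type*) [NonUnitalCStarAlgebra A] :
    ∃ l : Filter A, l.IsApproximateUnit := by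
  let _ := CStarAlgebra.spectralOrder A
  have := CStarAlgebra.spectralOrderedRing A
  exact ⟨_, (CStarAlgebra.increasingApproximateUnit A).toIsApproximateUnit⟩

open Filter Topology

/-- With a unit, `V x y = V (x * y) 1`; an approximate unit replaces it in the limit. -/
theorem sum_map_eq_zero_of_zero_product (V : A →L[ℂ] A →L[ℂ] E)
    (hV : ∀ a b, a * b = 0 → V a b = 0) {ι : Type*} (s : Finset ι) (x y : ι → A)
    (hxy : ∑ k ∈ s, x k * y k = 0) : ∑ k ∈ s, V (x k) (y k) = 0 := by
  obtain ⟨l, hl⟩ := exists_approximateUnit A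
  have := hl.neBot
  have lim : Tendsto (fun e => ∑ k ∈ s, V (x k) (y k * e)) l (𝓝 (∑ k ∈ s, V (x k) (y k))) :=
    tendsto_finsetSum _ fun k _ =>
      ((V (x k)).continuous.tendsto _).comp (hl.tendsto_mul_left (y k))
  refine tendsto_nhds_unique lim (tendsto_const_nhds.congr fun e => ?_)
  simp_rw [← map_mul_of_zero_product V hV]
  rw [← _root_.sum_apply, ← map_sum, hxy]
  simp

end ZeroProducts

/-! ### Products of linear maps and their amplifications. -/

section Amplification

variable {A B : Type*} [NonUnitalCStarAlgebra A] [NonUnitalCStarAlgebra B]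

open Filter Topology

/-- The bounded linear map `a ↦ φ(a*)*`. -/
noncomputable def ContinuousLinearMap.starConj (φ : A →L[ℂ] B) : A →L[ℂ] B :=
  ((starL ℂ : B ≃L⋆[ℂ] B) : B →L⋆[ℂ] B).comp (φ.comp ((starL ℂ : A ≃L⋆[ℂ] A) : A →L⋆[ℂ] A))

theorem ContinuousLinearMap.starConj_apply (φ : A →L[ℂ] B) (a : A) :
    φ.starConj a = star (φ (star a)) := rfl

/-- The bounded bilinear map `(a, b) ↦ φ(a) ψ(b)`. -/
noncomputable def ContinuousLinearMap.mulBilin (φ ψ : A →L[ℂ] B) : A →L[ℂ] A →L[ℂ] B :=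
  (ContinuousLinearMap.mul ℂ B).bilinearComp φ ψ

theorem ContinuousLinearMap.mulBilin_apply (φ ψ : A →L[ℂ] B) (a b : A) :
    φ.mulBilin ψ a b = φ a * ψ b := rfl

theorem sum_mul_eq_zero_of_zero_product {φ ψ : A →L[ℂ] B}
    (h : ∀ a b, a * b = 0 → φ a * ψ b = 0) {ι : Type*} (s : Finset ι) (x y : ι → A)
    (hxy : ∑ k ∈ s, x k * y k = 0) : ∑ k ∈ s, φ (x k) * ψ (y k) = 0 :=
  sum_map_eq_zero_of_zero_product (φ.mulBilin ψ) h s x y hxy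

theorem sum_mul_mul_eq_zero_of_zero_product {φ ψ χ : A →L[ℂ] B}
    (h : ∀ a b c, a * b * c = 0 → φ a * ψ b * χ c = 0) {ι : Type*} (s : Finset ι)
    (x y z : ι → A) (hxyz : ∑ k ∈ s, x k * y k * z k = 0) :
    ∑ k ∈ s, φ (x k) * ψ (y k) * χ (z k) = 0 := by
  obtain ⟨l, hl⟩ := exists_approximateUnit A
  have := hl.neBot
  -- Freezing an outer factor leaves a bilinear map that vanishes on zero-products.
  have right : ∀ a b c d, φ a * ψ (b * c) * χ d = φ a * ψ b * χ (c * d) := fun a b c d =>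
    map_mul_of_zero_product
      (((ContinuousLinearMap.mul ℂ B (φ a)).comp ψ).mulBilin χ)
      (fun u v huv => h a u v (by rw [mul_assoc, huv, mul_zero])) b c d
  have left : ∀ a b c d, φ (a * b) * ψ c * χ d = φ a * ψ (b * c) * χ d := by
    intro a b c d
    have := map_mul_of_zero_product
      (φ.mulBilin (((ContinuousLinearMap.mul ℂ B).flip (χ d)).comp ψ))
      (fun u v huv => by
        simpa [ContinuousLinearMap.mulBilin_apply, mul_assoc] using h u v d (by rw [huv, zero_mul]))
      a b c
    simpa [ContinuousLinearMap.mulBilin_apply, mul_assoc] using this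
  have lim : ∀ w : ι → A, Tendsto (fun e => ∑ k ∈ s, φ (x k) * ψ (w k) * χ (z k * e)) l
      (𝓝 (∑ k ∈ s, φ (x k) * ψ (w k) * χ (z k))) := fun w =>
    tendsto_finsetSum _ fun k _ =>
      ((χ.continuous.tendsto _).comp (hl.tendsto_mul_left (z k))).const_mul _
  have lim' : ∀ e, Tendsto (fun e' => ∑ k ∈ s, φ (x k) * ψ (y k * z k * e') * χ e) l
      (𝓝 (∑ k ∈ s, φ (x k) * ψ (y k * z k) * χ e)) := fun e =>
    tendsto_finsetSum _ fun k _ =>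
      (((ψ.continuous.tendsto _).comp (hl.tendsto_mul_left (y k * z k))).const_mul _).mul_const _
  -- Two approximate units, `e` in the last slot and `e'` in the middle one, let the whole product
  -- gather in the first.
  refine tendsto_nhds_unique (lim y) (tendsto_const_nhds.congr fun e => ?_)
  simp_rw [← right]
  refine (tendsto_nhds_unique (lim' e) (tendsto_const_nhds.congr fun e' => ?_)).symm
  simp_rw [← left, ← mul_assoc]
  rw [← Finset.sum_mul, ← Finset.sum_mul, ← map_sum, hxyz]
  simp

theorem amplification_apply (φ : A →L[ℂ] B) {n : ℕ} (M : CStarMatrix (Fin n) (Fin n) A)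
    (i j : Fin n) : amplification φ n M i j = φ (M i j) := rfl

theorem preservesZeroProducts_amplification {φ : A →L[ℂ] B} (h : PreservesZeroProducts φ)
    (n : ℕ) : PreservesZeroProducts (amplification φ n) := by
  intro M N hMN
  ext i j
  have := congr_fun₂ hMN i j
  rw [CStarMatrix.mul_apply] at this ⊢
  exact sum_mul_eq_zero_of_zero_product h _ _ _ this

theorem preservesRangeOrthogonality_amplification {φ : A →L[ℂ] B}
    (h : PreservesRangeOrthogonality φ) (n : ℕ) :
    PreservesRangeOrthogonality (amplification φ n) := by
  intro M N hMN
  ext i j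
  have := congr_fun₂ hMN i j
  rw [CStarMatrix.mul_apply] at this ⊢
  simpa [CStarMatrix.star_apply, amplification_apply, ContinuousLinearMap.starConj_apply] using
    sum_mul_eq_zero_of_zero_product (φ := φ.starConj) (ψ := φ)
      (fun a b hab => h (star a) b (by rwa [star_star])) _ _ _ this

theorem preservesDomainOrthogonality_amplification {φ : A →L[ℂ] B}
    (h : PreservesDomainOrthogonality φ) (n : ℕ) :
    PreservesDomainOrthogonality (amplification φ n) := by
  intro M N hMN
  ext i j
  have := congr_fun₂ hMN i j
  rw [CStarMatrix.mul_apply] at this ⊢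
  simpa [CStarMatrix.star_apply, amplification_apply, ContinuousLinearMap.starConj_apply] using
    sum_mul_eq_zero_of_zero_product (φ := φ) (ψ := φ.starConj)
      (fun a b hab => h a (star b) (by rwa [star_star])) _ _ _ this

theorem preservesZeroTROProducts_amplification {φ : A →L[ℂ] B}
    (h : PreservesZeroTROProducts φ) (n : ℕ) :
    PreservesZeroTROProducts (amplification φ n) := by
  intro L M N hLMN
  ext i j
  have := congr_fun₂ hLMN i j
  simp only [CStarMatrix.mul_apply, Finset.sum_mul, CStarMatrix.star_apply, amplification_apply]
    at this ⊢
  -- One sum over pairs of inner indices replaces the nested sums.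
  rw [← Finset.sum_product'] at this ⊢
  simpa [ContinuousLinearMap.starConj_apply] using
    sum_mul_mul_eq_zero_of_zero_product (φ := φ) (ψ := φ.starConj) (χ := φ)
      (fun a b c habc => h a (star b) c (by rwa [star_star])) _
      (fun p : Fin n × Fin n => L i p.2) (fun p => star (M p.1 p.2)) (fun p => N p.1 j) this

end Amplification

theorem corollary2p5 {A B : Type*} [NonUnitalCStarAlgebra A] [NonUnitalCStarAlgebra B]
    (φ : A →L[ℂ] B) :
    (PreservesZeroProducts φ → ∀ n : ℕ, 1 ≤ n → PreservesZeroProducts (amplification φ n)) ∧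
    (PreservesRangeOrthogonality φ →
      ∀ n : ℕ, 1 ≤ n → PreservesRangeOrthogonality (amplification φ n)) ∧
    (PreservesDomainOrthogonality φ →
      ∀ n : ℕ, 1 ≤ n → PreservesDomainOrthogonality (amplification φ n)) ∧
    (PreservesZeroTROProducts φ →
      ∀ n : ℕ, 1 ≤ n → PreservesZeroTROProducts (amplification φ n)) :=
  ⟨fun h n _ => preservesZeroProducts_amplification h n,
    fun h n _ => preservesRangeOrthogonality_amplification h n,
    fun h n _ => preservesDomainOrthogonality_amplification h n,
    fun h n _ => preservesZeroTROProducts_amplification h n⟩
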